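/- Let $a,b,x,y\in\{0,1\}$. A no-signalling behaviour is a family of conditional probabilities $p(ab|xy)$ such that $\sum_b p(ab|xy)$ does not depend on $y$ and $\sum_a p(ab|xy)$ does not depend on $x$. Let $\Pi_{\mathrm{NS}}$ be the set of joint distributions $\sigma(abxy)=\tfrac14\,p(ab|xy)$ with $p$ a no-signalling behaviour (uniform settings), and let $S_\sigma=\sum_{abxy}\sigma(abxy)\,4(-1)^{xy}(-1)^{a+b}$ be the standard CHSH value. The boxes below all carry uniform settings: $\mathrm{PR}$ is the behaviour with $p(ab|xy)=\tfrac12$ if $a\oplus b=xy$ and $0$ otherwise, and $\mathrm{LD}^{\alpha\beta\gamma\delta}$ is the deterministic behaviour $a=\alpha x\oplus\beta$, $b=\gamma y\oplus\delta$. For $\rho\in\Pi_{\mathrm{NS}}$ an attack on $\rho$ with side information in a finite set $\mathcal E$ is a joint distribution $\omega(abxye)$ with $\omega(ABXY|e)\in\Pi_{\mathrm{NS}}$ for every $e$ with $\omega(e)>0$ and $\sum_e\omega(ABXY|e)\,\omega(e)=\rho$; and $h_{\min}(\rho)$ is the infimum of the conditional Shannon entropies $\mathbb H_\omega(AB|XYE)$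 (base 2) over all attacks on $\rho$ and all finite $\mathcal E$. An entropy estimator of $\Pi_{\mathrm{NS}}$ is a function $K(abxy)$ with $\mathbb E_\sigma[K]\le\mathbb E_\sigma[-\log_2\sigma(AB|XY)]$ for all $\sigma\in\Pi_{\mathrm{NS}}$. A probability estimation factor (PEF) with power $\beta>0$ is a positive function $F(abxy)$ with $\mathbb E_\sigma[F\,\sigma(AB|XY)^\beta]\le1$ for all $\sigma\in\Pi_{\mathrm{NS}}$; its log-prob rate at $\sigma$ is $\mathcal O_\sigma(F;\beta)=\mathbb E_\sigma[\log_2F]/\beta$. Put $K_*(abxy)=1$ if $a\oplus b=xy$ and $K_*(abxy)=-3$ otherwise, and $F_k=2^{(K_*-e^{-k})\beta_k}$ for $k\ge1$. Then: 1. $S_{\mathrm{PR}}=4$, and exactly eight of the deterministic behaviours satisfy $S=2$: those with $\alpha\beta\gamma\delta\in\{0000,0101,0010,0111,1000,1101,1011,1110\}$. Call these $\mathrm{LD}_1,\dots,\mathrm{LD}_8$; together with $\mathrm{PR}$ they are nine distinct behaviours. 2. For every $\sigma\in\Pi_{\mathrm{NS}}$ with $S_\sigma>2$ one has $h_{\min}(\sigma)=(S_\sigma-2)/2$.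 There are weights $w_0=(S_\sigma-2)/2$ and $w_1,\dots,w_8\ge0$ with $\sum_{i=0}^8w_i=1$ and $\sigma=w_0\,\mathrm{PR}+\sum_{i=1}^8w_i\,\mathrm{LD}_i$, and the attack that prepares these nine behaviours with these probabilities attains $h_{\min}(\sigma)$. This optimal attack is unique: if an attack $\omega$ on $\sigma$ attains $h_{\min}(\sigma)$, then every $\omega(ABXY|e)$ with $\omega(e)>0$ is one of the nine behaviours, and the $i$-th of them is prepared with total probability $w_i$. 3. $K_*$ is an entropy estimator of $\Pi_{\mathrm{NS}}$, and $\mathbb E_\sigma[K_*]=h_{\min}(\sigma)$ for every $\sigma\in\Pi_{\mathrm{NS}}$ with $S_\sigma>2$. 4. There are $\beta_k>0$ such that $F_k$ is a PEF with power $\beta_k$ for every $k\ge1$. For every such choice and every $\sigma\in\Pi_{\mathrm{NS}}$ with $S_\sigma>2$: $\mathcal O_\sigma(F_k;\beta_k)=(S_\sigma-2)/2-e^{-k}$ for all $k\geq 1$; hence $\mathcal O_\sigma(F_k;\beta_k)\to h_{\min}(\sigma)$ as $k\to\infty$ and $\mathcal O_\sigma(F_k;\beta_k)>0$ for all sufficiently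 large $k$. Moreover no PEF, of any power $\beta>0$, has log-prob rate at $\sigma$ larger than $h_{\min}(\sigma)$. 5. $1+\dim\Pi_{\mathrm{NS}}=9$ (affine dimension), and nine values of the side information, which suffice by 2, are in general needed: if $\sigma\in\Pi_{\mathrm{NS}}$, $S_\sigma>2$ and all $\sigma(abxy)>0$, then every attack on $\sigma$ attaining $h_{\min}(\sigma)$ has $|\mathcal E|\ge9$; and such $\sigma$ exist. -/

import Mathlib

noncomputable section

open Filter Topology

namespace BellPEF

/-! ### Finite distributions, conditional probabilities, entropy

A (joint) distribution on a finite set `Ω` is a real function `Ω → ℝ` in `stdSimplex ℝ Ω`. -/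

section General

variable {Ω C Z E : Type} [Fintype Ω] [Fintype C] [Fintype Z] [Fintype E]

/-- The expectation `𝔼_μ[f]`. -/
def expect (μ f : Ω → ℝ) : ℝ := ∑ t, μ t * f t

/-- The conditional probability `μ(c|z)`, with value `0` when `μ(z) = 0`. -/
def condProb (μ : C × Z → ℝ) (t : C × Z) : ℝ := μ t / ∑ c, μ (c, t.2)

/-- The conditional Shannon entropy `ℍ_μ(C|Z) = 𝔼_μ[-log₂ μ(C|Z)]`.  For a distribution of
`(C, Z, E)`, seen as a function on `C × (Z × E)`, this is `ℍ_μ(C|ZE)`. -/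
def condEntropy (μ : C × Z → ℝ) : ℝ := expect μ (fun t => -Real.logb 2 (condProb μ t))

/-- `F` is a probability estimation factor with power `β` for the model `M`. -/
def IsPEF (M : Set (C × Z → ℝ)) (β : ℝ) (F : C × Z → ℝ) : Prop :=
  0 < β ∧ (∀ t, 0 < F t) ∧ ∀ σ ∈ M, expect σ (fun t => F t * condProb σ t ^ β) ≤ 1

/-- The log-prob rate `𝒪_ρ(F;β) = 𝔼_ρ[log₂ F] / β`. -/
def logProbRate (ρ F : Ω → ℝ) (β : ℝ) : ℝ := expect ρ (fun t => Real.logb 2 (F t)) / β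

/-- `K` is an entropy estimator of the model `M`. -/
def IsEntropyEstimator (M : Set (C × Z → ℝ)) (K : C × Z → ℝ) : Prop :=
  ∀ σ ∈ M, expect σ K ≤ expect σ (fun t => -Real.logb 2 (condProb σ t))

/-- The probability `ω(e)` of the side information `e`. -/
def sideProb (ω : C × Z × E → ℝ) (e : E) : ℝ := ∑ t : C × Z, ω (t.1, t.2, e)

/-- The conditional distribution `ω(CZ|e)` (meaningful when `ω(e) > 0`). -/
def sideCond (ω : C × Z × E → ℝ) (e : E) : C × Z → ℝ :=
  fun t => ω (t.1, t.2, e) / sideProb ω e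

variable (E) in
/-- The attacks on `ρ` with side information in `E`: distributions `ω(CZE)` with
`ω(CZ|e) ∈ M` for each `e` that occurs and `∑ₑ ω(CZ|e) ω(e) = ρ(CZ)`. -/
def attacks (M : Set (C × Z → ℝ)) (ρ : C × Z → ℝ) : Set (C × Z × E → ℝ) :=
  {ω | ω ∈ stdSimplex ℝ (C × Z × E) ∧
    (∀ e, 0 < sideProb ω e → sideCond ω e ∈ M) ∧
    ∀ t, ∑ e, sideCond ω e t * sideProb ω e = ρ t}

/-- `h_min(ρ)`: the infimum of `ℍ_ω(C|ZE)` over all attacks on `ρ`, the side information taking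
values in an arbitrary finite set. -/
def hmin (M : Set (C × Z → ℝ)) (ρ : C × Z → ℝ) : ℝ :=
  sInf {h | ∃ n : ℕ, ∃ ω ∈ attacks (Fin n) M ρ, h = condEntropy ω}

end General

/-! ### The (2,2,2) Bell scenario with uniform settings

Bits are booleans; `^^` is addition modulo 2 and `&&` is multiplication. -/

/-- Pairs `(a, b)` of outcomes. -/
abbrev Outcomes : Type := Bool × Bool

/-- Pairs `(x, y)` of settings. -/
abbrev Settings : Type := Bool × Bool

/-- The behaviour `p(ab|xy)` is a no-signalling behaviour. -/
structure IsNSBehaviour (p : Outcomes → Settings → ℝ) : Prop where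
  nonneg : ∀ ab xy, 0 ≤ p ab xy
  sum_eq_one : ∀ xy, ∑ ab, p ab xy = 1
  alice : ∀ a x y y', ∑ b, p (a, b) (x, y) = ∑ b, p (a, b) (x, y')
  bob : ∀ b x x' y, ∑ a, p (a, b) (x, y) = ∑ a, p (a, b) (x', y)

/-- The joint distribution `p(ab|xy) · 1/4` of a behaviour with uniform settings. -/
def joint (p : Outcomes → Settings → ℝ) : Outcomes × Settings → ℝ :=
  fun t => p t.1 t.2 * (1 / 4)

/-- The no-signalling model `Π_NS` with uniform settings. -/
def nsModel : Set (Outcomes × Settings → ℝ) := {μ | ∃ p, IsNSBehaviour p ∧ μ = joint p}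

/-- The expected standard CHSH value `S_μ`, i.e. the expectation of
`(-1)^(xy) (-1)^(a+b) / (1/4)`. -/
def chsh (μ : Outcomes × Settings → ℝ) : ℝ :=
  expect μ (fun t =>
    (-1) ^ (t.2.1.toNat * t.2.2.toNat) * (-1) ^ (t.1.1.toNat + t.1.2.toNat) / (1 / 4))

/-- The Popescu–Rohrlich behaviours. -/
def prBox (α β γ : Bool) : Outcomes → Settings → ℝ := fun (a, b) (x, y) =>
  if (a ^^ b) = ((x && y) ^^ (α && x) ^^ (β && y) ^^ γ) then 1 / 2 else 0

/-- The local deterministic behaviours. -/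
def ldBox (α β γ δ : Bool) : Outcomes → Settings → ℝ := fun (a, b) (x, y) =>
  if a = ((α && x) ^^ β) ∧ b = ((γ && y) ^^ δ) then 1 else 0

/-- The parameters `(α, β, γ, δ)` of the eight local deterministic behaviours that saturate the
standard CHSH inequality. -/
def satLD : Fin 8 → Bool × Bool × Bool × Bool :=
  ![(false, false, false, false), (false, true, false, true),
    (false, false, true, false), (false, true, true, true),
    (true, false, false, false), (true, true, false, true),
    (true, false, true, true), (true, true, true, false)]

/-- The nine vertices of the nonlocal simplex: the PR box at index `0`, then the eight saturating
local deterministic behaviours, all with uniform settings. -/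
def vertex : Fin 9 → Outcomes × Settings → ℝ :=
  Fin.cons (α := fun _ => Outcomes × Settings → ℝ) (joint (prBox false false false))
    (fun i => joint (ldBox (satLD i).1 (satLD i).2.1 (satLD i).2.2.1 (satLD i).2.2.2))

/-- The attack that prepares the `e`-th vertex with probability `w e`. -/
def vertexAttack (w : Fin 9 → ℝ) : Outcomes × Settings × Fin 9 → ℝ :=
  fun t => w t.2.2 * vertex t.2.2 (t.1, t.2.1)

/-- The function `K_*`: `1` if `a ⊕ b = xy` and `-3` otherwise. -/
def Kstar : Outcomes × Settings → ℝ := fun t =>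
  if (t.1.1 ^^ t.1.2) = (t.2.1 && t.2.2) then 1 else -3

/-- The function `2 ^ ((K_* - e^(-k)) β)`. -/
def Fseq (k : ℕ) (β : ℝ) : Outcomes × Settings → ℝ := fun t =>
  (2 : ℝ) ^ ((Kstar t - Real.exp (-(k : ℝ))) * β)

end BellPEF

end

/-!
The whole argument rests on one decomposition.  Each of the eight deterministic behaviours
saturating the CHSH inequality violates `a ⊕ b = xy` at exactly one entry `(ab, xy)`, these eight
entries are distinct, and the PR box vanishes on all of them.  Hence the functionals
`σ ↦ 4 σ(lossEntry i)` and `σ ↦ 𝔼_σ[K_*] = (S_σ - 2) / 2` are dual to the nine vertices, and every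
`σ ∈ Π_NS` is the affine combination of the vertices with these coefficients
(`eq_sum_vertexCoord`).  The vertices are therefore linearly independent, which gives the dimension,
and the behaviours with `S_σ ≥ 2` form the simplex spanned by them.

The vertices have conditional entropies `1, 0, …, 0`, so concavity of the entropy gives
`𝔼_σ[K_*] ≤ ℍ_σ(AB|XY)` on the simplex, while for `S_σ < 2` the left-hand side is negative
(`expect_Kstar_le_condEntropy`).  Averaging this bound over the side information shows that every
attack has entropy at least `𝔼_σ[K_*]`, a value attained by preparing the vertices.  By strict
concavity the bound is tight only at a vertex (`exists_eq_vertex_of_condEntropy_le`), so optimal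
attacks prepare only vertices, and the duality fixes their weights.

The functional `σ ↦ 𝔼_σ[F σ(AB|XY)^β]` is convex on `Π_NS`, so on the simplex it is enough to bound
it at the vertices; where `S_σ ≤ 2` it is at most `𝔼_σ[F]`.  For `F = F_k` the value at the PR box
is at most `1` outright, and everything else reduces to
`3/4 · 2^((1 - ε) β) + 1/4 · 2^((-3 - ε) β) ≤ 1` with `ε = e^(-k)`, which holds for small `β > 0`
because the derivative at `β = 0` is `-ε log 2` (`isPEF_Fseq`, `exists_pos_rpow_le_one`).
Conversely, by Gibbs' inequality the log-prob rate of any PEF at a vertex is at most the entropy of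
the vertex, and averaging over the vertices bounds the rate at `σ` by `h_min(σ)`.
-/

noncomputable section

open Finset Filter Topology

namespace BellPEF

/-! ### Conditional entropy and side information -/

section General

variable {Ω C Z E : Type} [Fintype Ω] [Fintype C] [Fintype Z] [Fintype E]

lemma sideProb_nonneg {E : Type} {ω : C × Z × E → ℝ} (hω : ∀ t, 0 ≤ ω t) (e : E) :
    0 ≤ sideProb ω e :=
  sum_nonneg fun _ _ => hω _

lemma sideProb_mul_sideCond {E : Type} {ω : C × Z × E → ℝ} (hω : ∀ t, 0 ≤ ω t) (e : E) (t : C × Z) :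
    sideProb ω e * sideCond ω e t = ω (t.1, t.2, e) := by
  rcases eq_or_ne (sideProb ω e) 0 with h | h
  · have h0 := (sum_eq_zero_iff_of_nonneg (fun t _ => hω _)).1 h t (mem_univ t)
    simp [h, h0]
  · exact mul_div_cancel₀ _ h

lemma sum_sideProb (ω : C × Z × E → ℝ) : ∑ e, sideProb ω e = ∑ t, ω t := by
  simp only [sideProb, Fintype.sum_prod_type (f := fun t : C × Z => ω (t.1, t.2, _)),
    Fintype.sum_prod_type (f := ω), Fintype.sum_prod_type (α₁ := Z) (α₂ := E)]
  rw [sum_comm]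
  exact sum_congr rfl fun c _ => sum_comm

/-- The chain rule `ℍ(C|ZE) = ∑ₑ ω(e) ℍ(C|Z, E = e)`. -/
lemma condEntropy_eq_sum_sideProb {ω : C × Z × E → ℝ} (hω : ∀ t, 0 ≤ ω t) :
    condEntropy ω = ∑ e, sideProb ω e * condEntropy (sideCond ω e) := by
  have key : ∀ (e : E) (t : C × Z),
      ω (t.1, t.2, e) * -Real.logb 2 (condProb ω (t.1, t.2, e)) =
        sideProb ω e * (sideCond ω e t * -Real.logb 2 (condProb (sideCond ω e) t)) := by
    intro e t
    rw [← mul_assoc, sideProb_mul_sideCond hω]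
    rcases eq_or_ne (sideProb ω e) 0 with h | h
    · have h0 := sideProb_mul_sideCond hω e t
      rw [h, zero_mul] at h0
      simp [← h0]
    · congr 3
      simp only [condProb, sideCond, ← sum_div]
      exact (div_div_div_cancel_right₀ h _ _).symm
  simp only [condEntropy, expect, mul_sum, ← key]
  simp only [Fintype.sum_prod_type]
  calc _ = ∑ c, ∑ e, ∑ z, ω (c, z, e) * -Real.logb 2 (condProb ω (c, z, e)) :=
        sum_congr rfl fun c _ => sum_comm
    _ = _ := sum_comm

lemma expect_sum (w : E → ℝ) (μ : E → Ω → ℝ) (f : Ω → ℝ) :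
    expect (fun t => ∑ e, w e * μ e t) f = ∑ e, w e * expect (μ e) f := by
  simp only [expect, sum_mul, mul_sum, mul_assoc]
  exact sum_comm

/-- Gibbs' inequality in the form used here: a function whose `β`-weighted mean at `μ` is at most
`1` has log-prob rate at most the conditional entropy at `μ`. -/
lemma expect_logb_le_mul_condEntropy {μ F : C × Z → ℝ} {β : ℝ}
    (hμ : μ ∈ stdSimplex ℝ (C × Z)) (hF : ∀ t, 0 < F t)
    (h : expect μ (fun t => F t * condProb μ t ^ β) ≤ 1) :
    expect μ (fun t => Real.logb 2 (F t)) ≤ β * condEntropy μ := by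
  have hlog : 0 < Real.log 2 := Real.log_pos one_lt_two
  have key : ∀ t, μ t * (Real.log (F t) + β * Real.log (condProb μ t)) ≤
      μ t * (F t * condProb μ t ^ β) - μ t := by
    intro t
    rcases (hμ.1 t).eq_or_lt with h0 | h0
    · simp [← h0]
    · have hz : 0 < ∑ c, μ (c, t.2) :=
        h0.trans_le (single_le_sum (f := fun c => μ (c, t.2)) (fun c _ => hμ.1 _) (mem_univ t.1))
      have hc : 0 < condProb μ t := div_pos h0 hz
      have hcβ := Real.rpow_pos_of_pos hc β
      rw [← Real.log_rpow hc, ← Real.log_mul (hF t).ne' hcβ.ne']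
      nlinarith [Real.log_le_sub_one_of_pos (mul_pos (hF t) hcβ)]
  have hsum := sum_le_sum fun t (_ : t ∈ univ) => key t
  rw [sum_sub_distrib, hμ.2] at hsum
  have hle : ∑ t, μ t * (Real.log (F t) + β * Real.log (condProb μ t)) ≤ 0 :=
    hsum.trans (sub_nonpos.2 h)
  have heq : ∑ t, μ t * (Real.log (F t) + β * Real.log (condProb μ t)) =
      Real.log 2 * (expect μ (fun t => Real.logb 2 (F t)) - β * condEntropy μ) := by
    simp only [condEntropy, expect, mul_sum, ← sum_sub_distrib]
    refine sum_congr rfl fun t _ => ?_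
    simp only [Real.logb]
    field_simp
    ring
  rw [heq] at hle
  linarith [nonpos_of_mul_nonpos_right hle hlog]

end General

/-! ### The no-signalling model -/

lemma IsNSBehaviour.prBox (α β γ : Bool) : IsNSBehaviour (prBox α β γ) where
  nonneg := by rintro ⟨a, b⟩ ⟨x, y⟩; simp only [BellPEF.prBox]; split_ifs <;> norm_num
  sum_eq_one := by
    rintro ⟨x, y⟩
    simp only [BellPEF.prBox, Fintype.sum_prod_type, Fintype.sum_bool]
    generalize ((x && y) ^^ (α && x) ^^ (β && y) ^^ γ) = c
    cases c <;> norm_num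
  alice := by
    intro a x y y'
    have h : ∀ c : Bool, ∑ b, (if (a ^^ b) = c then (1 / 2 : ℝ) else 0) = 1 / 2 := by
      cases a <;> simp
    simp only [BellPEF.prBox, h]
  bob := by
    intro b x x' y
    have h : ∀ c : Bool, ∑ a, (if (a ^^ b) = c then (1 / 2 : ℝ) else 0) = 1 / 2 := by
      cases b <;> simp
    simp only [BellPEF.prBox, h]

lemma IsNSBehaviour.ldBox (α β γ δ : Bool) : IsNSBehaviour (ldBox α β γ δ) where
  nonneg := by rintro ⟨a, b⟩ ⟨x, y⟩; simp only [BellPEF.ldBox]; split_ifs <;> norm_num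
  sum_eq_one := by
    rintro ⟨x, y⟩
    simp only [BellPEF.ldBox, Fintype.sum_prod_type, ite_and, sum_ite_irrel, sum_const_zero,
      sum_ite_eq', mem_univ, if_true]
  alice := by
    intro a x y y'
    simp only [BellPEF.ldBox, ite_and, sum_ite_irrel, sum_ite_eq', mem_univ]
  bob := by
    intro b x x' y
    simp only [BellPEF.ldBox, ite_and, sum_ite_eq', mem_univ]

lemma vertex_mem_nsModel (j : Fin 9) : vertex j ∈ nsModel := by
  refine Fin.cases ?_ (fun i => ?_) j
  · exact ⟨_, IsNSBehaviour.prBox _ _ _, rfl⟩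
  · exact ⟨_, IsNSBehaviour.ldBox _ _ _ _, rfl⟩

section Model

variable {σ : Outcomes × Settings → ℝ}

lemma nonneg_of_mem_nsModel (hσ : σ ∈ nsModel) (t) : 0 ≤ σ t := by
  obtain ⟨p, hp, rfl⟩ := hσ
  exact mul_nonneg (hp.nonneg _ _) (by norm_num)

lemma sum_outcomes_of_mem_nsModel (hσ : σ ∈ nsModel) (z : Settings) :
    ∑ c, σ (c, z) = 1 / 4 := by
  obtain ⟨p, hp, rfl⟩ := hσ
  simp only [joint, ← sum_mul, hp.sum_eq_one, one_mul]

lemma mem_stdSimplex_of_mem_nsModel (hσ : σ ∈ nsModel) :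
    σ ∈ stdSimplex ℝ (Outcomes × Settings) := by
  refine ⟨nonneg_of_mem_nsModel hσ, ?_⟩
  rw [Fintype.sum_prod_type, sum_comm]
  simp only [sum_outcomes_of_mem_nsModel hσ]
  simp

lemma condProb_of_mem_nsModel (hσ : σ ∈ nsModel) (t) : condProb σ t = 4 * σ t := by
  rw [condProb, sum_outcomes_of_mem_nsModel hσ]
  ring

lemma four_mul_le_one_of_mem_nsModel (hσ : σ ∈ nsModel) (t) : 4 * σ t ≤ 1 := by
  have := single_le_sum (f := fun c => σ (c, t.2))
    (fun c _ => nonneg_of_mem_nsModel hσ _) (mem_univ t.1)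
  rw [sum_outcomes_of_mem_nsModel hσ] at this
  linarith [show σ t = σ (t.1, t.2) from rfl]

lemma condEntropy_of_mem_nsModel (hσ : σ ∈ nsModel) :
    condEntropy σ = (∑ t, Real.negMulLog (4 * σ t)) / (4 * Real.log 2) := by
  simp only [condEntropy, expect, condProb_of_mem_nsModel hσ, Real.negMulLog, Real.logb, sum_div]
  refine sum_congr rfl fun t _ => ?_
  have := (Real.log_pos one_lt_two).ne'
  field_simp

lemma condEntropy_nonneg_of_mem_nsModel (hσ : σ ∈ nsModel) : 0 ≤ condEntropy σ := by
  rw [condEntropy_of_mem_nsModel hσ]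
  have := Real.log_pos one_lt_two
  refine div_nonneg (sum_nonneg fun t _ => ?_) (by positivity)
  exact Real.negMulLog_nonneg (by linarith [nonneg_of_mem_nsModel hσ t])
    (four_mul_le_one_of_mem_nsModel hσ t)

end Model

/-! ### Coordinates with respect to the nine vertices -/

/-- The entry at which the `i`-th saturating deterministic behaviour violates `a ⊕ b = xy`; it
occurs at the settings `x = ¬γ`, `y = ¬α`. -/
def lossEntry (i : Fin 8) : Outcomes × Settings :=
  match satLD i with
  | (α, β, γ, δ) => (((α && !γ) ^^ β, (γ && !α) ^^ δ), (!γ, !α))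

/-- The functions whose expectations are the barycentric coordinates with respect to `vertex`:
`K_*` for the PR box, and `4` times the indicator of the loss entry for each deterministic
behaviour. -/
def vertexCoord : Fin 9 → Outcomes × Settings → ℝ :=
  Fin.cons (α := fun _ => Outcomes × Settings → ℝ) Kstar
    (fun i t => if t = lossEntry i then 4 else 0)

lemma expect_vertexCoord_succ (μ : Outcomes × Settings → ℝ) (i : Fin 8) :
    expect μ (vertexCoord i.succ) = 4 * μ (lossEntry i) := by
  simp [vertexCoord, expect, mul_comm]

lemma vertex_succ_lossEntry (i l : Fin 8) :
    vertex l.succ (lossEntry i) = if i = l then 1 / 4 else 0 := by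
  have h : ∀ i l : Fin 8,
      (((lossEntry i).1.1 = (((satLD l).1 && (lossEntry i).2.1) ^^ (satLD l).2.1)) ∧
      ((lossEntry i).1.2 = (((satLD l).2.2.1 && (lossEntry i).2.2) ^^ (satLD l).2.2.2))) ↔
      i = l := by decide
  simp only [vertex, Fin.cons_succ, joint, ldBox, h]
  split_ifs <;> norm_num

lemma vertex_zero_lossEntry (i : Fin 8) : vertex 0 (lossEntry i) = 0 := by
  have h : ∀ i : Fin 8, ¬ ((lossEntry i).1.1 ^^ (lossEntry i).1.2) =
      (((lossEntry i).2.1 && (lossEntry i).2.2) ^^ (false && (lossEntry i).2.1) ^^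
        (false && (lossEntry i).2.2) ^^ false) := by decide
  simp only [vertex, Fin.cons_zero, joint, prBox, h i, if_false, zero_mul]

lemma expect_Kstar {σ : Outcomes × Settings → ℝ} (hσ : σ ∈ stdSimplex ℝ (Outcomes × Settings)) :
    expect σ Kstar = (chsh σ - 2) / 2 := by
  have h := hσ.2
  simp only [chsh, expect, Kstar, Fintype.sum_prod_type, Fintype.sum_bool] at h ⊢
  norm_num at h ⊢
  linarith

lemma chsh_vertex_zero : chsh (vertex 0) = 4 := by
  simp [chsh, expect, vertex, joint, prBox, Fintype.sum_prod_type]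
  norm_num

lemma chsh_ldBox (α β γ δ : Bool) :
    chsh (joint (ldBox α β γ δ)) = if (β ^^ δ) = (α && γ) then 2 else -2 := by
  simp only [chsh, expect, joint, ldBox, Fintype.sum_prod_type, Fintype.sum_bool]
  cases α <;> cases β <;> cases γ <;> cases δ <;> norm_num

lemma mem_range_satLD (α β γ δ : Bool) :
    (α, β, γ, δ) ∈ Set.range satLD ↔ (β ^^ δ) = (α && γ) := by
  have h : ∀ α β γ δ : Bool, (∃ i, satLD i = (α, β, γ, δ)) ↔ (β ^^ δ) = (α && γ) := by decide
  exact h α β γ δ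

lemma chsh_ldBox_eq_two_iff (α β γ δ : Bool) :
    chsh (joint (ldBox α β γ δ)) = 2 ↔ (α, β, γ, δ) ∈ Set.range satLD := by
  rw [chsh_ldBox, mem_range_satLD]
  split_ifs with h <;> simp [h]
  norm_num

lemma chsh_vertex_succ (i : Fin 8) : chsh (vertex i.succ) = 2 :=
  (chsh_ldBox_eq_two_iff _ _ _ _).2 ⟨i, rfl⟩

lemma expect_vertexCoord_vertex (j k : Fin 9) :
    expect (vertex k) (vertexCoord j) = if j = k then 1 else 0 := by
  refine Fin.cases ?_ (fun i => ?_) j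
  · change expect (vertex k) Kstar = _
    rw [expect_Kstar (mem_stdSimplex_of_mem_nsModel (vertex_mem_nsModel k))]
    refine Fin.cases ?_ (fun l => ?_) k
    · rw [chsh_vertex_zero]; norm_num
    · rw [chsh_vertex_succ, if_neg (Fin.succ_ne_zero l).symm]; norm_num
  · rw [expect_vertexCoord_succ]
    refine Fin.cases ?_ (fun l => ?_) k
    · rw [vertex_zero_lossEntry, if_neg (Fin.succ_ne_zero i), mul_zero]
    · simp only [vertex_succ_lossEntry, Fin.succ_inj]
      split_ifs <;> norm_num

lemma vertex_injective : Function.Injective vertex := by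
  intro j k h
  have h1 := expect_vertexCoord_vertex j k
  rw [← h, expect_vertexCoord_vertex] at h1
  by_contra hjk
  simp [hjk] at h1

/-- A combination of the vertices determines its weights. -/
lemma expect_vertexCoord_of_eq_sum {σ : Outcomes × Settings → ℝ} {w : Fin 9 → ℝ}
    (h : ∀ t, σ t = ∑ e, w e * vertex e t) (j : Fin 9) : expect σ (vertexCoord j) = w j := by
  rw [funext h, expect_sum]
  simp [expect_vertexCoord_vertex]

/-- The eight deterministic vertices have mutually distinct loss entries, and the PR box has none,
so the weights are read off from `σ`; no-signalling makes the remaining eight entries agree.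
The weight of the PR box may be negative here. -/
lemma eq_sum_vertexCoord {σ : Outcomes × Settings → ℝ} (hσ : σ ∈ nsModel)
    (t : Outcomes × Settings) :
    σ t = ∑ e, expect σ (vertexCoord e) * vertex e t := by
  rw [Fin.sum_univ_succ]
  simp only [expect_vertexCoord_succ]
  change σ t = expect σ Kstar * joint (prBox false false false) t + ∑ i, 4 * σ (lossEntry i) *
    joint (ldBox (satLD i).1 (satLD i).2.1 (satLD i).2.2.1 (satLD i).2.2.2) t
  obtain ⟨p, hp, rfl⟩ := hσ
  have h1 := hp.sum_eq_one
  have h2 := hp.alice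
  have h3 := hp.bob
  simp only [Fintype.sum_prod_type, Fintype.sum_bool] at h1 h2 h3
  have n1 := h1 (false, false)
  have n2 := h1 (false, true)
  have n3 := h1 (true, false)
  have n4 := h1 (true, true)
  have a1 := h2 false false false true
  have a2 := h2 false true false true
  have b1 := h3 false false true false
  have b2 := h3 false false true true
  simp only [Fin.sum_univ_eight, expect, Kstar, joint, lossEntry, satLD, Fintype.sum_prod_type,
    Fintype.sum_bool]
  obtain ⟨⟨a, b⟩, x, y⟩ := t
  cases a <;> cases b <;> cases x <;> cases y <;> simp [prBox, ldBox] <;> linarith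

lemma sum_expect_vertexCoord {σ : Outcomes × Settings → ℝ} (hσ : σ ∈ nsModel) :
    ∑ e, expect σ (vertexCoord e) = 1 := by
  have h := (mem_stdSimplex_of_mem_nsModel hσ).2
  simp only [eq_sum_vertexCoord hσ] at h
  rw [sum_comm] at h
  simpa only [← mul_sum, (mem_stdSimplex_of_mem_nsModel (vertex_mem_nsModel _)).2, mul_one] using h

lemma expect_vertexCoord_zero {σ : Outcomes × Settings → ℝ} (hσ : σ ∈ nsModel) :
    expect σ (vertexCoord 0) = (chsh σ - 2) / 2 :=
  expect_Kstar (mem_stdSimplex_of_mem_nsModel hσ)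

/-- The behaviours with CHSH value at least `2` form the simplex spanned by the nine vertices. -/
lemma vertexCoord_mem_stdSimplex {σ : Outcomes × Settings → ℝ} (hσ : σ ∈ nsModel)
    (hS : 2 ≤ chsh σ) : (fun e => expect σ (vertexCoord e)) ∈ stdSimplex ℝ (Fin 9) := by
  refine ⟨fun e => ?_, sum_expect_vertexCoord hσ⟩
  change 0 ≤ expect σ (vertexCoord e)
  refine Fin.cases ?_ (fun i => ?_) e
  · rw [expect_vertexCoord_zero hσ]
    linarith
  · rw [expect_vertexCoord_succ]
    linarith [nonneg_of_mem_nsModel hσ (lossEntry i)]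

/-! ### Entropy on the nonlocal simplex -/

section Concavity

variable {ι : Type} [Fintype ι] {w : ι → ℝ} {μ : ι → Outcomes × Settings → ℝ}
  {σ : Outcomes × Settings → ℝ}

lemma sum_negMulLog_le (hw : w ∈ stdSimplex ℝ ι) (hμ : ∀ e, μ e ∈ nsModel)
    (h : ∀ t, σ t = ∑ e, w e * μ e t) (t : Outcomes × Settings) :
    ∑ e, w e * Real.negMulLog (4 * μ e t) ≤ Real.negMulLog (4 * σ t) := by
  have := Real.concaveOn_negMulLog.le_map_sum (t := univ) (w := w) (p := fun e => 4 * μ e t)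
    (fun e _ => hw.1 e) hw.2
    (fun e _ => mul_nonneg (by norm_num) (nonneg_of_mem_nsModel (hμ e) t))
  simpa only [smul_eq_mul, h t, mul_sum, mul_left_comm (4 : ℝ)] using this

lemma sum_mul_condEntropy (hμ : ∀ e, μ e ∈ nsModel) :
    ∑ e, w e * condEntropy (μ e) =
      (∑ t, ∑ e, w e * Real.negMulLog (4 * μ e t)) / (4 * Real.log 2) := by
  simp only [condEntropy_of_mem_nsModel (hμ _), ← mul_div_assoc, ← sum_div, mul_sum]
  rw [sum_comm]

lemma sum_mul_condEntropy_le (hw : w ∈ stdSimplex ℝ ι) (hμ : ∀ e, μ e ∈ nsModel)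
    (hσ : σ ∈ nsModel) (h : ∀ t, σ t = ∑ e, w e * μ e t) :
    ∑ e, w e * condEntropy (μ e) ≤ condEntropy σ := by
  have := Real.log_pos one_lt_two
  rw [sum_mul_condEntropy hμ, condEntropy_of_mem_nsModel hσ]
  gcongr with t
  exact sum_negMulLog_le hw hμ h t

/-- Strict concavity of the conditional entropy on the no-signalling model. -/
lemma eq_of_condEntropy_le_sum (hw : w ∈ stdSimplex ℝ ι) (hμ : ∀ e, μ e ∈ nsModel)
    (hσ : σ ∈ nsModel) (h : ∀ t, σ t = ∑ e, w e * μ e t)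
    (heq : condEntropy σ ≤ ∑ e, w e * condEntropy (μ e)) {j k : ι} (hj : w j ≠ 0)
    (hk : w k ≠ 0) : μ j = μ k := by
  have hlog := Real.log_pos one_lt_two
  rw [sum_mul_condEntropy hμ, condEntropy_of_mem_nsModel hσ,
    div_le_div_iff_of_pos_right (by positivity)] at heq
  have hle := fun t (_ : t ∈ univ) => sum_negMulLog_le hw hμ h t
  have hall := (sum_eq_sum_iff_of_le hle).1 (le_antisymm (sum_le_sum hle) heq)
  funext t
  have ht := hall t (mem_univ t)
  have := (Real.strictConcaveOn_negMulLog.map_sum_eq_iff_of_nonneg (t := univ) (w := w)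
    (p := fun e => 4 * μ e t) (fun e _ => hw.1 e) hw.2
    (fun e _ => mul_nonneg (by norm_num) (nonneg_of_mem_nsModel (hμ e) t))).1
    (by simpa only [smul_eq_mul, h t, mul_sum, mul_left_comm (4 : ℝ)] using ht.symm)
    (mem_univ j) hj (mem_univ k) hk
  simpa using this

end Concavity

lemma condEntropy_vertex_zero : condEntropy (vertex 0) = 1 := by
  have hlog := Real.log_pos one_lt_two
  have h : ∀ t, Real.negMulLog (4 * vertex 0 t) =
      if (t.1.1 ^^ t.1.2) = (t.2.1 && t.2.2) then Real.log 2 / 2 else 0 := by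
    rintro ⟨⟨a, b⟩, x, y⟩
    simp only [vertex, Fin.cons_zero, joint, prBox, Bool.false_and, Bool.xor_false]
    split_ifs
    · rw [show (4 : ℝ) * (1 / 2 * (1 / 4)) = 2⁻¹ by norm_num, Real.negMulLog, Real.log_inv]
      ring
    · simp
  rw [condEntropy_of_mem_nsModel (vertex_mem_nsModel 0)]
  simp only [h, Fintype.sum_prod_type, Fintype.sum_bool]
  simp
  field_simp
  norm_num

lemma condEntropy_vertex_succ (i : Fin 8) : condEntropy (vertex i.succ) = 0 := by
  rw [condEntropy_of_mem_nsModel (vertex_mem_nsModel _), sum_eq_zero, zero_div]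
  rintro ⟨⟨a, b⟩, x, y⟩ -
  simp only [vertex, Fin.cons_succ, joint, ldBox]
  split_ifs <;> simp

lemma sum_mul_condEntropy_vertex (w : Fin 9 → ℝ) :
    ∑ e, w e * condEntropy (vertex e) = w 0 := by
  simp [Fin.sum_univ_succ (n := 8), condEntropy_vertex_zero, condEntropy_vertex_succ]

lemma expect_Kstar_le_condEntropy {σ : Outcomes × Settings → ℝ} (hσ : σ ∈ nsModel) :
    expect σ Kstar ≤ condEntropy σ := by
  rcases le_or_gt 2 (chsh σ) with hS | hS
  · have := sum_mul_condEntropy_le (vertexCoord_mem_stdSimplex hσ hS) vertex_mem_nsModel hσ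
      (eq_sum_vertexCoord hσ)
    rwa [sum_mul_condEntropy_vertex] at this
  · rw [expect_Kstar (mem_stdSimplex_of_mem_nsModel hσ)]
    linarith [condEntropy_nonneg_of_mem_nsModel hσ]

/-- The entropy estimate of `K_*` is tight only at the nine vertices. -/
lemma exists_eq_vertex_of_condEntropy_le {σ : Outcomes × Settings → ℝ} (hσ : σ ∈ nsModel)
    (h : condEntropy σ ≤ expect σ Kstar) : ∃ j, σ = vertex j := by
  have hS : 2 ≤ chsh σ := by
    rw [expect_Kstar (mem_stdSimplex_of_mem_nsModel hσ)] at h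
    linarith [condEntropy_nonneg_of_mem_nsModel hσ]
  have hw := vertexCoord_mem_stdSimplex hσ hS
  obtain ⟨j, hj⟩ : ∃ j, expect σ (vertexCoord j) ≠ 0 := by
    by_contra! h0
    simpa [h0] using hw.2
  refine ⟨j, ?_⟩
  have hk : ∀ k, k ≠ j → expect σ (vertexCoord k) = 0 := fun k hkj => by
    by_contra hk
    exact hkj (vertex_injective (eq_of_condEntropy_le_sum hw vertex_mem_nsModel hσ
      (eq_sum_vertexCoord hσ) (by rwa [sum_mul_condEntropy_vertex]) hk hj))
  have hj1 : expect σ (vertexCoord j) = 1 := by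
    rw [← sum_expect_vertexCoord hσ, sum_eq_single j (fun k _ => hk k) (by simp)]
  funext t
  rw [eq_sum_vertexCoord hσ t, sum_eq_single j (fun k _ hkj => by rw [hk k hkj, zero_mul])
    (by simp), hj1, one_mul]

/-! ### Attacks and `h_min` -/

section Attacks

variable {E : Type} [Fintype E] {σ : Outcomes × Settings → ℝ} {ω : Outcomes × Settings × E → ℝ}

lemma eq_sum_of_mem_attacks (hω : ω ∈ attacks E nsModel σ) :
    σ = fun t => ∑ e, sideProb ω e * sideCond ω e t := by
  funext t
  simp only [← hω.2.2 t, mul_comm]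

lemma sideProb_mul_le (hω : ω ∈ attacks E nsModel σ) (e : E) :
    sideProb ω e * expect (sideCond ω e) Kstar ≤ sideProb ω e * condEntropy (sideCond ω e) := by
  rcases (sideProb_nonneg hω.1.1 e).eq_or_lt with h | h
  · simp [← h]
  · exact mul_le_mul_of_nonneg_left (expect_Kstar_le_condEntropy (hω.2.1 e h)) h.le

lemma expect_Kstar_eq_sum_sideProb (hω : ω ∈ attacks E nsModel σ) :
    expect σ Kstar = ∑ e, sideProb ω e * expect (sideCond ω e) Kstar := by
  conv_lhs => rw [eq_sum_of_mem_attacks hω]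
  exact expect_sum _ _ _

lemma expect_Kstar_le_of_mem_attacks (hω : ω ∈ attacks E nsModel σ) :
    expect σ Kstar ≤ condEntropy ω := by
  rw [expect_Kstar_eq_sum_sideProb hω, condEntropy_eq_sum_sideProb hω.1.1]
  exact sum_le_sum fun e _ => sideProb_mul_le hω e

lemma exists_sideCond_eq_vertex (hω : ω ∈ attacks E nsModel σ)
    (h : condEntropy ω = expect σ Kstar) {e : E} (he : 0 < sideProb ω e) :
    ∃ j, sideCond ω e = vertex j := by
  rw [expect_Kstar_eq_sum_sideProb hω, condEntropy_eq_sum_sideProb hω.1.1] at h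
  have := (sum_eq_sum_iff_of_le fun e _ => sideProb_mul_le hω e).1 h.symm e (mem_univ e)
  exact exists_eq_vertex_of_condEntropy_le (hω.2.1 e he) (mul_left_cancel₀ he.ne' this).ge

open scoped Classical in
lemma sum_sideProb_eq_vertexCoord (hω : ω ∈ attacks E nsModel σ)
    (h : condEntropy ω = expect σ Kstar) (j : Fin 9) :
    ∑ e with sideCond ω e = vertex j, sideProb ω e = expect σ (vertexCoord j) := by
  conv_rhs => rw [eq_sum_of_mem_attacks hω, expect_sum]
  rw [sum_filter]
  refine sum_congr rfl fun e _ => ?_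
  rcases (sideProb_nonneg hω.1.1 e).eq_or_lt with h0 | h0
  · simp [← h0]
  · obtain ⟨k, hk⟩ := exists_sideCond_eq_vertex hω h h0
    simp only [hk, vertex_injective.eq_iff, expect_vertexCoord_vertex, eq_comm (a := k)]
    simp

/-- When every vertex has positive weight, an optimal attack prepares every vertex. -/
lemma card_le_of_condEntropy_eq (hω : ω ∈ attacks E nsModel σ)
    (h : condEntropy ω = expect σ Kstar) (hpos : ∀ j, 0 < expect σ (vertexCoord j)) :
    9 ≤ Fintype.card E := by
  classical
  have hex : ∀ j, ∃ e, sideCond ω e = vertex j := fun j => by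
    have hj := sum_sideProb_eq_vertexCoord hω h j
    obtain ⟨e, he, -⟩ := exists_ne_zero_of_sum_ne_zero (hj.trans_ne (hpos j).ne')
    exact ⟨e, (mem_filter.1 he).2⟩
  choose f hf using hex
  have hinj : Function.Injective f := fun j k hjk =>
    vertex_injective (by rw [← hf, ← hf, hjk])
  simpa using Fintype.card_le_of_injective f hinj

end Attacks

section VertexAttack

variable {w : Fin 9 → ℝ} {σ : Outcomes × Settings → ℝ}

lemma sideProb_vertexAttack (e : Fin 9) : sideProb (vertexAttack w) e = w e := by
  simp only [sideProb, vertexAttack, ← mul_sum]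
  exact (congrArg _ (mem_stdSimplex_of_mem_nsModel (vertex_mem_nsModel e)).2).trans (mul_one _)

lemma vertexAttack_nonneg (hw : w ∈ stdSimplex ℝ (Fin 9)) (t) : 0 ≤ vertexAttack w t :=
  mul_nonneg (hw.1 _) (nonneg_of_mem_nsModel (vertex_mem_nsModel _) _)

lemma sideCond_vertexAttack {e : Fin 9} (he : w e ≠ 0) :
    sideCond (vertexAttack w) e = vertex e := by
  funext t
  rw [sideCond, sideProb_vertexAttack, vertexAttack]
  exact mul_div_cancel_left₀ _ he

lemma vertexAttack_mem_attacks (hw : w ∈ stdSimplex ℝ (Fin 9))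
    (h : ∀ t, σ t = ∑ e, w e * vertex e t) : vertexAttack w ∈ attacks (Fin 9) nsModel σ := by
  refine ⟨⟨vertexAttack_nonneg hw, ?_⟩, fun e he => ?_, fun t => ?_⟩
  · simp only [← sum_sideProb, sideProb_vertexAttack, hw.2]
  · rw [sideProb_vertexAttack] at he
    rw [sideCond_vertexAttack he.ne']
    exact vertex_mem_nsModel e
  · rw [h t]
    refine sum_congr rfl fun e _ => ?_
    rw [mul_comm, sideProb_mul_sideCond (vertexAttack_nonneg hw)]
    rfl

lemma condEntropy_vertexAttack (hw : w ∈ stdSimplex ℝ (Fin 9)) :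
    condEntropy (vertexAttack w) = w 0 := by
  rw [condEntropy_eq_sum_sideProb (vertexAttack_nonneg hw), ← sum_mul_condEntropy_vertex w]
  refine sum_congr rfl fun e _ => ?_
  rw [sideProb_vertexAttack]
  rcases eq_or_ne (w e) 0 with h | h
  · simp [h]
  · rw [sideCond_vertexAttack h]

end VertexAttack

lemma hmin_eq_expect_Kstar {σ : Outcomes × Settings → ℝ} (hσ : σ ∈ nsModel) (hS : 2 < chsh σ) :
    hmin nsModel σ = expect σ Kstar := by
  have hw := vertexCoord_mem_stdSimplex hσ hS.le
  refine IsLeast.csInf_eq ⟨⟨9, _, vertexAttack_mem_attacks hw (eq_sum_vertexCoord hσ), ?_⟩, ?_⟩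
  · rw [condEntropy_vertexAttack hw]
    rfl
  · rintro _ ⟨n, ω, hω, rfl⟩
    exact expect_Kstar_le_of_mem_attacks hω

/-! ### Probability estimation factors -/

lemma expect_mul_condProb_rpow {σ F : Outcomes × Settings → ℝ} {β : ℝ} (hσ : σ ∈ nsModel)
    (hβ : 0 < β) :
    expect σ (fun t => F t * condProb σ t ^ β) = ∑ t, F t / 4 * (4 * σ t) ^ (1 + β) := by
  simp only [expect, condProb_of_mem_nsModel hσ]
  refine sum_congr rfl fun t _ => ?_
  have h4 : 0 ≤ 4 * σ t := mul_nonneg (by norm_num) (nonneg_of_mem_nsModel hσ t)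
  rw [Real.rpow_add_of_nonneg h4 zero_le_one hβ.le, Real.rpow_one]
  ring

lemma expect_mul_condProb_rpow_le_expect {σ F : Outcomes × Settings → ℝ} {β : ℝ}
    (hσ : σ ∈ nsModel) (hF : ∀ t, 0 < F t) (hβ : 0 < β) :
    expect σ (fun t => F t * condProb σ t ^ β) ≤ expect σ F := by
  refine sum_le_sum fun t _ => mul_le_mul_of_nonneg_left ?_ (nonneg_of_mem_nsModel hσ t)
  refine mul_le_of_le_one_right (hF t).le (Real.rpow_le_one ?_ ?_ hβ.le)
  · rw [condProb_of_mem_nsModel hσ]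
    linarith [nonneg_of_mem_nsModel hσ t]
  · rw [condProb_of_mem_nsModel hσ]
    exact four_mul_le_one_of_mem_nsModel hσ t

/-- The functional bounded in the definition of a PEF is convex on the no-signalling model, hence
on the nonlocal simplex it is bounded by its values at the vertices. -/
lemma expect_mul_condProb_rpow_le_sum {σ F : Outcomes × Settings → ℝ} {β : ℝ}
    (hσ : σ ∈ nsModel) (hS : 2 ≤ chsh σ) (hF : ∀ t, 0 < F t) (hβ : 0 < β) :
    expect σ (fun t => F t * condProb σ t ^ β) ≤ ∑ e, expect σ (vertexCoord e) *
      expect (vertex e) (fun t => F t * condProb (vertex e) t ^ β) := by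
  have hw := vertexCoord_mem_stdSimplex hσ hS
  simp only [expect_mul_condProb_rpow hσ hβ, expect_mul_condProb_rpow (vertex_mem_nsModel _) hβ]
  simp only [mul_sum]
  rw [sum_comm]
  refine sum_le_sum fun t _ => ?_
  have h := (convexOn_rpow (p := 1 + β) (by linarith)).map_sum_le (t := univ)
    (w := fun e => expect σ (vertexCoord e)) (p := fun e => 4 * vertex e t)
    (fun e _ => hw.1 e) hw.2
    (fun e _ => mul_nonneg (by norm_num) (nonneg_of_mem_nsModel (vertex_mem_nsModel e) t))
  simp only [smul_eq_mul, mul_left_comm _ (4 : ℝ), ← mul_sum, ← eq_sum_vertexCoord hσ t] at h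
  refine (mul_le_mul_of_nonneg_left h (div_pos (hF t) four_pos).le).trans_eq ?_
  rw [mul_sum]
  exact sum_congr rfl fun e _ => mul_left_comm _ _ _

lemma Fseq_pos (k : ℕ) (β : ℝ) (t) : 0 < Fseq k β t := Real.rpow_pos_of_pos two_pos _

/-- `F_k` takes one value on the entries with `a ⊕ b = xy` and another on the remaining ones, so
its expectation is an affine function of the CHSH value. -/
lemma expect_Fseq {σ : Outcomes × Settings → ℝ} (hσ : σ ∈ nsModel) (k : ℕ) (β : ℝ) :
    expect σ (Fseq k β) =
      (4 + chsh σ) / 8 * 2 ^ ((1 - Real.exp (-(k : ℝ))) * β) +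
      (4 - chsh σ) / 8 * 2 ^ ((-3 - Real.exp (-(k : ℝ))) * β) := by
  have hs := mem_stdSimplex_of_mem_nsModel hσ
  set A : ℝ := 2 ^ ((1 - Real.exp (-(k : ℝ))) * β) with hA
  set B : ℝ := 2 ^ ((-3 - Real.exp (-(k : ℝ))) * β) with hB
  have hF : ∀ t, Fseq k β t = (3 * A + B) / 4 + (A - B) / 4 * Kstar t := by
    intro t
    simp only [Fseq, Kstar]
    split_ifs <;> simp only [← hA, ← hB] <;> ring
  have : expect σ (Fseq k β) = (3 * A + B) / 4 * (∑ t, σ t) + (A - B) / 4 * expect σ Kstar := by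
    simp only [expect, mul_sum, ← sum_add_distrib, hF]
    exact sum_congr rfl fun t _ => by ring
  rw [this, hs.2, expect_Kstar hs]
  ring

lemma expect_vertex_zero_Fseq_le {β : ℝ} (hβ : 0 < β) (k : ℕ) :
    expect (vertex 0) (fun t => Fseq k β t * condProb (vertex 0) t ^ β) ≤ 1 := by
  have hz : condProb (vertex 0) = fun t => if Kstar t = 1 then (1 / 2 : ℝ) else 0 := by
    funext t
    rw [condProb_of_mem_nsModel (vertex_mem_nsModel 0)]
    simp only [vertex, Fin.cons_zero, joint, prBox, Kstar, Bool.false_and, Bool.xor_false]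
    split_ifs <;> norm_num at *
  have hle : ∀ t, Fseq k β t * condProb (vertex 0) t ^ β ≤ 1 := by
    intro t
    simp only [hz, Fseq]
    split_ifs with h
    · rw [h, one_div, Real.inv_rpow zero_le_two, ← Real.rpow_neg zero_le_two,
        ← Real.rpow_add two_pos]
      refine Real.rpow_le_one_of_one_le_of_nonpos one_le_two ?_
      nlinarith [Real.exp_pos (-(k : ℝ))]
    · rw [Real.zero_rpow hβ.ne', mul_zero]
      exact zero_le_one
  have hs := mem_stdSimplex_of_mem_nsModel (vertex_mem_nsModel 0)
  rw [← hs.2]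
  exact sum_le_sum fun t _ => mul_le_of_le_one_right (hs.1 t) (hle t)

/-- For `F_k` to be a PEF it suffices to bound its expectation at CHSH value `2`: below this value
the factor `σ(AB|XY)^β ≤ 1` is dropped, and above it convexity reduces the claim to the vertices. -/
lemma isPEF_Fseq {β : ℝ} (hβ : 0 < β) (k : ℕ)
    (h : 3 / 4 * (2 : ℝ) ^ ((1 - Real.exp (-(k : ℝ))) * β) +
      1 / 4 * 2 ^ ((-3 - Real.exp (-(k : ℝ))) * β) ≤ 1) :
    IsPEF nsModel β (Fseq k β) := by
  have hlocal : ∀ σ ∈ nsModel, chsh σ ≤ 2 →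
      expect σ (fun t => Fseq k β t * condProb σ t ^ β) ≤ 1 := by
    intro σ hσ hS
    refine (expect_mul_condProb_rpow_le_expect hσ (Fseq_pos k β) hβ).trans ?_
    rw [expect_Fseq hσ]
    have hBA : (2 : ℝ) ^ ((-3 - Real.exp (-(k : ℝ))) * β) ≤
        2 ^ ((1 - Real.exp (-(k : ℝ))) * β) :=
      Real.rpow_le_rpow_of_exponent_le one_le_two (by nlinarith)
    nlinarith
  refine ⟨hβ, Fseq_pos k β, fun σ hσ => ?_⟩
  rcases le_total (chsh σ) 2 with hS | hS
  · exact hlocal σ hσ hS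
  · have hw := vertexCoord_mem_stdSimplex hσ hS
    refine (expect_mul_condProb_rpow_le_sum hσ hS (Fseq_pos k β) hβ).trans ?_
    rw [← hw.2]
    refine sum_le_sum fun e _ => mul_le_of_le_one_right (hw.1 e) ?_
    refine Fin.cases (expect_vertex_zero_Fseq_le hβ k) (fun i => ?_) e
    exact hlocal _ (vertex_mem_nsModel _) (chsh_vertex_succ i).le

/-- The left-hand side equals `1` at `β = 0` and has derivative `-ε log 2` there. -/
lemma exists_pos_rpow_le_one {ε : ℝ} (hε : 0 < ε) :
    ∃ β : ℝ, 0 < β ∧ 3 / 4 * (2 : ℝ) ^ ((1 - ε) * β) + 1 / 4 * 2 ^ ((-3 - ε) * β) ≤ 1 := by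
  have hlog := Real.log_pos one_lt_two
  have hd : ∀ c : ℝ, HasDerivAt (fun β : ℝ => (2 : ℝ) ^ (c * β)) (c * Real.log 2) 0 := by
    intro c
    have := ((hasDerivAt_id (0 : ℝ)).const_mul c).const_rpow (a := 2) two_pos
    simpa [mul_comm] using this
  have h := ((hd (1 - ε)).const_mul (3 / 4)).add ((hd (-3 - ε)).const_mul (1 / 4))
  have hneg : 3 / 4 * ((1 - ε) * Real.log 2) + 1 / 4 * ((-3 - ε) * Real.log 2) < 0 := by
    nlinarith [mul_pos hε hlog]
  have hev := ((hasDerivAt_iff_tendsto_slope.1 h).eventually_lt_const hneg).filter_mono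
    (nhdsWithin_mono 0 (fun x (hx : x ∈ Set.Ioi (0 : ℝ)) => (ne_of_gt hx)))
  obtain ⟨β, hs, hβ⟩ := (hev.and self_mem_nhdsWithin).exists
  refine ⟨β, hβ, ?_⟩
  have hβ' : 0 < β := hβ
  rw [slope_def_field, div_neg_iff] at hs
  simp at hs
  rcases hs with hs | hs <;> linarith

lemma exists_isPEF_Fseq (k : ℕ) : ∃ β, IsPEF nsModel β (Fseq k β) := by
  obtain ⟨β, hβ, h⟩ := exists_pos_rpow_le_one (Real.exp_pos (-(k : ℝ)))
  exact ⟨β, isPEF_Fseq hβ k h⟩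

lemma logProbRate_Fseq {σ : Outcomes × Settings → ℝ} (hσ : σ ∈ nsModel) {β : ℝ} (hβ : 0 < β)
    (k : ℕ) : logProbRate σ (Fseq k β) β = (chsh σ - 2) / 2 - Real.exp (-(k : ℝ)) := by
  have hs := mem_stdSimplex_of_mem_nsModel hσ
  rw [logProbRate, div_eq_iff hβ.ne', ← expect_Kstar hs, ← mul_one (Real.exp _), ← hs.2]
  simp only [expect, Fseq, Real.logb_rpow two_pos one_lt_two.ne', mul_sum, ← sum_sub_distrib,
    sum_mul]
  exact sum_congr rfl fun t _ => by ring

/-- The log-prob rate is affine in `σ`, so the bound by the conditional entropy at each vertex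
passes to the nonlocal simplex, where the average entropy of the vertices is `𝔼_σ[K_*]`. -/
lemma logProbRate_le_expect_Kstar {σ F : Outcomes × Settings → ℝ} (hσ : σ ∈ nsModel)
    (hS : 2 ≤ chsh σ) {β : ℝ} (hF : IsPEF nsModel β F) :
    logProbRate σ F β ≤ expect σ Kstar := by
  have hw := vertexCoord_mem_stdSimplex hσ hS
  rw [logProbRate, div_le_iff₀' hF.1]
  calc expect σ (fun t => Real.logb 2 (F t))
      = ∑ e, expect σ (vertexCoord e) * expect (vertex e) (fun t => Real.logb 2 (F t)) := by
        conv_lhs => rw [funext (eq_sum_vertexCoord hσ), expect_sum]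
    _ ≤ ∑ e, expect σ (vertexCoord e) * (β * condEntropy (vertex e)) :=
        sum_le_sum fun e _ => mul_le_mul_of_nonneg_left
          (expect_logb_le_mul_condEntropy (mem_stdSimplex_of_mem_nsModel (vertex_mem_nsModel e))
            hF.2.1 (hF.2.2 _ (vertex_mem_nsModel e))) (hw.1 e)
    _ = β * ∑ e, expect σ (vertexCoord e) * condEntropy (vertex e) := by
        simp only [mul_sum, mul_left_comm β]
    _ = β * expect σ Kstar := by rw [sum_mul_condEntropy_vertex]; rfl

/-! ### Dimension and full support -/

lemma linearIndependent_vertex : LinearIndependent ℝ vertex := by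
  rw [Fintype.linearIndependent_iff]
  intro g hg j
  have h : ∀ t, (0 : Outcomes × Settings → ℝ) t = ∑ e, g e * vertex e t := fun t => by
    rw [← hg]
    simp
  rw [← expect_vertexCoord_of_eq_sum h j]
  simp [expect]

lemma affineSpan_nsModel : affineSpan ℝ nsModel = affineSpan ℝ (Set.range vertex) := by
  apply le_antisymm
  · rw [affineSpan_le]
    intro σ hσ
    have hsum := sum_expect_vertexCoord hσ
    have := affineCombination_mem_affineSpan hsum vertex
    rw [affineCombination_eq_linear_combination _ _ _ hsum] at this
    have heq : σ = ∑ e, expect σ (vertexCoord e) • vertex e := by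
      funext t
      simpa using eq_sum_vertexCoord hσ t
    rwa [← heq] at this
  · refine affineSpan_mono ℝ ?_
    rintro _ ⟨j, rfl⟩
    exact vertex_mem_nsModel j

lemma finrank_vectorSpan_nsModel : Module.finrank ℝ (vectorSpan ℝ nsModel) = 8 := by
  rw [← direction_affineSpan, affineSpan_nsModel, direction_affineSpan]
  exact linearIndependent_vertex.affineIndependent.finrank_vectorSpan (by simp)

/-- The witness is the isotropic behaviour that satisfies `a ⊕ b = xy` with probability `9/10`. -/
lemma exists_pos_mem_nsModel : ∃ σ ∈ nsModel, 2 < chsh σ ∧ ∀ t, 0 < σ t := by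
  let p : Outcomes → Settings → ℝ := fun c z =>
    if (c.1 ^^ c.2) = (z.1 && z.2) then 9 / 20 else 1 / 20
  have hp : IsNSBehaviour p :=
    { nonneg := fun c z => by simp only [p]; split_ifs <;> norm_num
      sum_eq_one := by
        rintro ⟨x, y⟩
        cases x <;> cases y <;> simp [p, Fintype.sum_prod_type] <;> norm_num
      alice := by
        intro a x y y'
        cases a <;> cases x <;> cases y <;> cases y' <;> simp [p] <;> norm_num
      bob := by
        intro b x x' y
        cases b <;> cases x <;> cases x' <;> cases y <;> simp [p] <;> norm_num }
  refine ⟨joint p, ⟨p, hp, rfl⟩, ?_, fun t => ?_⟩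
  · simp [chsh, expect, joint, p, Fintype.sum_prod_type]
    norm_num
  · refine mul_pos ?_ (by norm_num)
    simp only [p]
    split_ifs <;> norm_num

lemma vertexCoord_pos {σ : Outcomes × Settings → ℝ} (hσ : σ ∈ nsModel) (hS : 2 < chsh σ)
    (hpos : ∀ t, 0 < σ t) (j : Fin 9) : 0 < expect σ (vertexCoord j) := by
  refine Fin.cases ?_ (fun i => ?_) j
  · rw [expect_vertexCoord_zero hσ]
    linarith
  · rw [expect_vertexCoord_succ]
    linarith [hpos (lossEntry i)]

end BellPEF

end

open BellPEF Filter Topology in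
open scoped Classical in
theorem mainTheorem5 :
    -- the standard PR box has CHSH value 4; the eight listed local deterministic behaviours are
    -- distinct and are exactly those saturating the CHSH inequality
    (chsh (vertex 0) = 4 ∧ Function.Injective vertex ∧
      ∀ α β γ δ : Bool, chsh (joint (ldBox α β γ δ)) = 2 ↔ (α, β, γ, δ) ∈ Set.range satLD) ∧
    -- the value of `h_min`, and the optimal attack, which is unique
    (∀ σ ∈ nsModel, 2 < chsh σ →
      hmin nsModel σ = (chsh σ - 2) / 2 ∧
      ∃ w ∈ stdSimplex ℝ (Fin 9),
        w 0 = (chsh σ - 2) / 2 ∧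
        (∀ t, σ t = ∑ e, w e * vertex e t) ∧
        vertexAttack w ∈ attacks (Fin 9) nsModel σ ∧
        condEntropy (vertexAttack w) = hmin nsModel σ ∧
        ∀ (n : ℕ), ∀ ω ∈ attacks (Fin n) nsModel σ, condEntropy ω = hmin nsModel σ →
          (∀ e, 0 < sideProb ω e → ∃ j, sideCond ω e = vertex j) ∧
          ∀ j, ∑ e with sideCond ω e = vertex j, sideProb ω e = w j) ∧
    -- `K_*` is an entropy estimator whose entropy estimate is `h_min`
    (IsEntropyEstimator nsModel Kstar ∧
      ∀ σ ∈ nsModel, 2 < chsh σ → expect σ Kstar = hmin nsModel σ) ∧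
    -- powers making every `F_k` a PEF exist, and for all such powers the sequence is
    -- asymptotically optimal and eventually certifies randomness
    ((∃ β : ℕ → ℝ, ∀ k, 1 ≤ k → IsPEF nsModel (β k) (Fseq k (β k))) ∧
      ∀ β : ℕ → ℝ, (∀ k, 1 ≤ k → IsPEF nsModel (β k) (Fseq k (β k))) →
        ∀ σ ∈ nsModel, 2 < chsh σ →
          (∀ k, 1 ≤ k → logProbRate σ (Fseq k (β k)) (β k)
            = (chsh σ - 2) / 2 - Real.exp (-(k : ℝ))) ∧
          Tendsto (fun k => logProbRate σ (Fseq k (β k)) (β k)) atTop (𝓝 (hmin nsModel σ)) ∧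
          ∀ᶠ k in atTop, 0 < logProbRate σ (Fseq k (β k)) (β k)) ∧
    -- no PEF has a log-prob rate above `h_min`
    (∀ σ ∈ nsModel, 2 < chsh σ → ∀ (β : ℝ) (F : Outcomes × Settings → ℝ),
      IsPEF nsModel β F → logProbRate σ F β ≤ hmin nsModel σ) ∧
    -- the bound `9 = 1 + dim Π_NS` on the number of values of the side information is tight
    (1 + Module.finrank ℝ (vectorSpan ℝ nsModel) = 9 ∧
      (∀ σ ∈ nsModel, 2 < chsh σ → (∀ t, 0 < σ t) →
        ∀ (n : ℕ), ∀ ω ∈ attacks (Fin n) nsModel σ, condEntropy ω = hmin nsModel σ → 9 ≤ n) ∧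
      ∃ σ ∈ nsModel, 2 < chsh σ ∧ ∀ t, 0 < σ t) := by
  refine ⟨⟨chsh_vertex_zero, vertex_injective, chsh_ldBox_eq_two_iff⟩, fun σ hσ hS => ?_,
    ⟨fun σ hσ => expect_Kstar_le_condEntropy hσ,
      fun σ hσ hS => (hmin_eq_expect_Kstar hσ hS).symm⟩, ⟨?_, fun β hβ σ hσ hS => ?_⟩,
    fun σ hσ hS β F hF => ?_, by rw [finrank_vectorSpan_nsModel],
    fun σ hσ hS hpos n ω hω h => ?_, exists_pos_mem_nsModel⟩
  · have hmin_eq := hmin_eq_expect_Kstar hσ hS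
    have hw := vertexCoord_mem_stdSimplex hσ hS.le
    have hdec := eq_sum_vertexCoord hσ
    refine ⟨hmin_eq.trans (expect_vertexCoord_zero hσ), _, hw, expect_vertexCoord_zero hσ, hdec,
      vertexAttack_mem_attacks hw hdec, (condEntropy_vertexAttack hw).trans hmin_eq.symm,
      fun n ω hω h => ?_⟩
    rw [hmin_eq] at h
    exact ⟨fun e he => exists_sideCond_eq_vertex hω h he, sum_sideProb_eq_vertexCoord hω h⟩
  · choose β hβ using exists_isPEF_Fseq
    exact ⟨β, fun k _ => hβ k⟩
  · have hrate : ∀ k, 1 ≤ k → logProbRate σ (Fseq k (β k)) (β k)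
        = (chsh σ - 2) / 2 - Real.exp (-(k : ℝ)) :=
      fun k hk => logProbRate_Fseq hσ (hβ k hk).1 k
    have hlim : Tendsto (fun k => logProbRate σ (Fseq k (β k)) (β k)) atTop
        (𝓝 ((chsh σ - 2) / 2)) := by
      have hexp : Tendsto (fun k : ℕ => Real.exp (-(k : ℝ))) atTop (𝓝 0) :=
        Real.tendsto_exp_neg_atTop_nhds_zero.comp tendsto_natCast_atTop_atTop
      have := hexp.const_sub ((chsh σ - 2) / 2)
      rw [sub_zero] at this
      refine this.congr' ?_
      filter_upwards [eventually_ge_atTop 1] with k hk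
      exact (hrate k hk).symm
    refine ⟨hrate, ?_, hlim.eventually_const_lt (by linarith)⟩
    rwa [hmin_eq_expect_Kstar hσ hS, expect_Kstar (mem_stdSimplex_of_mem_nsModel hσ)]
  · rw [hmin_eq_expect_Kstar hσ hS]
    exact logProbRate_le_expect_Kstar hσ hS.le hF
  · rw [hmin_eq_expect_Kstar hσ hS] at h
    simpa using card_le_of_condEntropy_eq hω h (vertexCoord_pos hσ hS hpos)
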